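/- Let $A\in\mathbb{C}^{m\times m}$, $B\in\mathbb{C}^{m\times n}$, $C\in\mathbb{C}^{n\times m}$, $D\in\mathbb{C}^{n\times n}$ (in particular, they may be real), and consider the nonsymmetric algebraic Riccati equation (NARE) and its dual $$XCX-XD-AX+B=0,\qquad YBY-YA-DY+C=0 .$$ Let $\mathbb{C}_-$ be the open left half plane, $\lambda(\cdot)$ the spectrum, $\rho(\cdot)$ the spectral radius and $\|\cdot\|$ the spectral norm. A solution $X$ of the NARE is called stabilizing if $\lambda(D-CX)\subset\mathbb{C}_-$, and a solution $Y$ of the dual is called stabilizing if $\lambda(A-BY)\subset\mathbb{C}_-$. Put $$\mathcal{H}=\begin{bmatrix}D&-C\\B&-A\end{bmatrix},\qquad \mathcal{C}^{\alpha,\beta}(M)=(\alpha I+M)^{-1}(\beta I-M)$$ (also for scalars $M$), and $A_\tau=\tau I+A$, $D_\tau=\tau I+D$. Let $\alpha,\beta\in\mathbb{C}$ be such that $D_\alpha$, $A_\beta$, $A_\beta-BD_\alpha^{-1}C$, $A_{-\alpha}-BD_\alpha^{-1}C$ and $D_{-\beta}-CA_\beta^{-1}B$ are nonsingular (then $D_\alpha-CA_\beta^{-1}B$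 is nonsingular too), and set $$\begin{aligned} E_0&=-(D_\alpha-CA_\beta^{-1}B)^{-1}(D_{-\beta}-CA_\beta^{-1}B), & F_0&=-(A_\beta-BD_\alpha^{-1}C)^{-1}(A_{-\alpha}-BD_\alpha^{-1}C),\\ G_0&=(\alpha+\beta)(D_\alpha-CA_\beta^{-1}B)^{-1}CA_\beta^{-1}, & H_0&=(\alpha+\beta)(A_\beta-BD_\alpha^{-1}C)^{-1}BD_\alpha^{-1}. \end{aligned}$$ Assume that the NARE has a stabilizing solution $X_\star$ and that the dual equation has a stabilizing solution $Y_\star$. Assume the spectral separation condition $$|\mathcal{C}^{\alpha,\beta}(\lambda_i)^{-1}|>|\mathcal{C}^{\alpha,\beta}(\lambda_j)^{-1}|\quad\text{for all }\lambda_i\in\lambda(\mathcal{H})\cap\mathbb{C}_-,\ \lambda_j\in\lambda(\mathcal{H})\setminus\mathbb{C}_- ,$$ and that the iteration $$X_0=0,\qquad X_{t+1}=H_0+F_0X_t(I-G_0X_t)^{-1}E_0$$ does not break down, that is, $I-G_0X_t$ is nonsingular for all $t\ge 0$. Let $R=-\mathcal{C}^{\alpha,\beta}(D-CX_\star)$ and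 $S=-\mathcal{C}^{\beta,\alpha}(A-BY_\star)$. Then: 1. $X_\star$ is the unique stabilizing solution of the NARE, $Y_\star$ is the unique stabilizing solution of the dual equation, and $X_t\to X_\star$ as $t\to\infty$. 2. For all $t\ge 0$, $$X_t=X_\star-(I-X_tY_\star)S^tX_\star R^t .$$ Moreover $\rho(R)\rho(S)<1$ and, if $X_\star\neq0$, the convergence is linear with asymptotic rate at most $\rho(R)\rho(S)$: the following limit exists and satisfies $$\lim_{t\to\infty}\left(\frac{\|X_t-X_\star\|}{\|X_\star\|}\right)^{1/t}\le\rho(R)\rho(S).$$ -/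

import Mathlib

open Filter Topology
open scoped Matrix.Norms.L2Operator

namespace NARE

noncomputable section

variable {m n : Type*} [Fintype m] [DecidableEq m] [Fintype n] [DecidableEq n]

/-- The Hamiltonian-like matrix `[[D, -C], [B, -A]]` of the NARE `X C X - X D - A X + B = 0`. -/
def hamiltonian (A : Matrix m m ℂ) (B : Matrix m n ℂ) (C : Matrix n m ℂ) (D : Matrix n n ℂ) :
    Matrix (n ⊕ m) (n ⊕ m) ℂ :=
  Matrix.fromBlocks D (-C) B (-A)

/-- `X` solves the NARE `X C X - X D - A X + B = 0` and the closed-loop matrix `D - C X` has its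
spectrum in the open left half plane. The dual equation `Y B Y - Y A - D Y + C = 0`, with
closed-loop matrix `A - B Y`, is obtained by exchanging `A` with `D` and `B` with `C`. -/
def IsStabilizingSolution (A : Matrix m m ℂ) (B : Matrix m n ℂ) (C : Matrix n m ℂ)
    (D : Matrix n n ℂ) (X : Matrix m n ℂ) : Prop :=
  X * C * X - X * D - A * X + B = 0 ∧ ∀ z ∈ spectrum ℂ (D - C * X), z.re < 0

/-- The generalized Cayley transform `(α I + M)⁻¹ (β I - M)` of a square matrix. -/
def cayley (α β : ℂ) (M : Matrix n n ℂ) : Matrix n n ℂ :=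
  (α • (1 : Matrix n n ℂ) + M)⁻¹ * (β • (1 : Matrix n n ℂ) - M)

/-- The generalized Cayley transform of a scalar. -/
def cayleyScalar (α β z : ℂ) : ℂ := (α + z)⁻¹ * (β - z)

/-- The shifted matrix `τ I + M`. -/
def shift (τ : ℂ) (M : Matrix n n ℂ) : Matrix n n ℂ := τ • (1 : Matrix n n ℂ) + M

/-- The coefficient `E₀ = -(D_α - C A_β⁻¹ B)⁻¹ (D_{-β} - C A_β⁻¹ B)`. -/
def E₀ (A : Matrix m m ℂ) (B : Matrix m n ℂ) (C : Matrix n m ℂ) (D : Matrix n n ℂ) (α β : ℂ) :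
    Matrix n n ℂ :=
  -((shift α D - C * (shift β A)⁻¹ * B)⁻¹ * (shift (-β) D - C * (shift β A)⁻¹ * B))

/-- The coefficient `F₀ = -(A_β - B D_α⁻¹ C)⁻¹ (A_{-α} - B D_α⁻¹ C)`. -/
def F₀ (A : Matrix m m ℂ) (B : Matrix m n ℂ) (C : Matrix n m ℂ) (D : Matrix n n ℂ) (α β : ℂ) :
    Matrix m m ℂ :=
  -((shift β A - B * (shift α D)⁻¹ * C)⁻¹ * (shift (-α) A - B * (shift α D)⁻¹ * C))

/-- The coefficient `G₀ = (α + β) (D_α - C A_β⁻¹ B)⁻¹ C A_β⁻¹`. -/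
def G₀ (A : Matrix m m ℂ) (B : Matrix m n ℂ) (C : Matrix n m ℂ) (D : Matrix n n ℂ) (α β : ℂ) :
    Matrix n m ℂ :=
  (α + β) • ((shift α D - C * (shift β A)⁻¹ * B)⁻¹ * C * (shift β A)⁻¹)

/-- The coefficient `H₀ = (α + β) (A_β - B D_α⁻¹ C)⁻¹ B D_α⁻¹`. -/
def H₀ (A : Matrix m m ℂ) (B : Matrix m n ℂ) (C : Matrix n m ℂ) (D : Matrix n n ℂ) (α β : ℂ) :
    Matrix m n ℂ :=
  (α + β) • ((shift β A - B * (shift α D)⁻¹ * C)⁻¹ * B * (shift α D)⁻¹)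

/-- The fixed-point iteration `X₀ = 0`, `X_{t+1} = H₀ + F₀ X_t (I - G₀ X_t)⁻¹ E₀`. -/
def iter (A : Matrix m m ℂ) (B : Matrix m n ℂ) (C : Matrix n m ℂ) (D : Matrix n n ℂ) (α β : ℂ) :
    ℕ → Matrix m n ℂ
  | 0 => 0
  | t + 1 => H₀ A B C D α β + F₀ A B C D α β * iter A B C D α β t *
      (1 - G₀ A B C D α β * iter A B C D α β t)⁻¹ * E₀ A B C D α β

/-- The nonsingularity conditions imposed on the shift pair `(α, β)`. -/
structure AdmissibleShift (A : Matrix m m ℂ) (B : Matrix m n ℂ) (C : Matrix n m ℂ)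
    (D : Matrix n n ℂ) (α β : ℂ) : Prop where
  isUnit_D : IsUnit (shift α D)
  isUnit_A : IsUnit (shift β A)
  isUnit_schur_A : IsUnit (shift β A - B * (shift α D)⁻¹ * C)
  isUnit_schur_A' : IsUnit (shift (-α) A - B * (shift α D)⁻¹ * C)
  isUnit_schur_D : IsUnit (shift (-β) D - C * (shift β A)⁻¹ * B)

/-- The spectral separation condition: every eigenvalue of the Hamiltonian-like matrix in the open
left half plane has an inverse Cayley transform of larger modulus than every other eigenvalue. -/
def SpectralSeparation (A : Matrix m m ℂ) (B : Matrix m n ℂ) (C : Matrix n m ℂ)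
    (D : Matrix n n ℂ) (α β : ℂ) : Prop :=
  ∀ zi ∈ spectrum ℂ (hamiltonian A B C D), zi.re < 0 →
    ∀ zj ∈ spectrum ℂ (hamiltonian A B C D), ¬ zj.re < 0 →
      ‖(cayleyScalar α β zj)⁻¹‖ < ‖(cayleyScalar α β zi)⁻¹‖

/-- The iteration does not break down: every matrix that it has to invert is nonsingular. -/
def NoBreakdown (A : Matrix m m ℂ) (B : Matrix m n ℂ) (C : Matrix n m ℂ) (D : Matrix n n ℂ)
    (α β : ℂ) : Prop :=
  ∀ t, IsUnit (1 - G₀ A B C D α β * iter A B C D α β t)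

end

end NARE

/-!
Write `ℋ` for the Hamiltonian-like matrix `[[D, -C], [B, -A]]`. A solution `X` of the equation says
that the graph `[1; X]` is `ℋ`-invariant with restriction `D - C * X`, and a solution `Y` of the
dual equation says that `[Y; 1]` is `ℋ`-invariant with restriction `-(A - B * Y)`. For stabilizing
`X` and `Y` the two restrictions have disjoint spectra, so the two graphs intersect trivially, which
means that `1 - X * Y` is invertible (`isUnit_one_sub_mul`). The difference of two stabilizing
solutions then satisfies a homogeneous Sylvester equation with disjoint spectra, hence vanishes
(`IsStabilizingSolution.unique`).

Applying the Cayley transform to the invariance relations gives `E₀ = (1 - G₀ X) R'`,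
`X - H₀ = F₀ X R'` with `R' = cayley α β (D - C * X)` (`E₀_eq`, `sub_H₀_eq`), and, exchanging the
roles of the equation and its dual, `F₀ = (1 - H₀ Y) S'`, `Y - G₀ = E₀ Y S'`. From these four
identities one step of the iteration maps the error relation `X - Z = (1 - Z Y) P` to the same
relation with `S' P R'` in place of `P` (`sub_step_eq`), and the exact error formula
`X - X_t = (1 - X_t Y) P_t` with `P_t = S ^ t * X * R ^ t` follows by induction (`sub_iter_eq`);
here `R = -R'` and `S = -S'`, and the signs cancel in pairs.

The eigenvalues of `R` and `S` are Cayley transforms of eigenvalues of `ℋ`, so spectral separation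
says that `ρ(R) ρ(S) < 1` (`spectralRadius_mul_lt_one`), and Gelfand's formula gives `P_t → 0`. The
error formula, solved for the error and for `P_t`, shows that `‖X_t - X‖` and `‖P_t‖` are
comparable (`exists_norm_sub_le`, `exists_norm_le_norm_sub`). Finally `P_t` is the orbit of `X` under
the linear operator `Z ↦ S * Z * R`, and every orbit of an operator on a finite-dimensional complex
space has an asymptotic rate: the spectral radius of the operator on the cyclic subspace that the
orbit spans (`exists_tendsto_norm_pow_apply_root`).
-/

namespace NARE

/-! ### Intertwining relations and Sylvester equations -/

section Intertwine

variable {m n : Type*} [Fintype m] [DecidableEq m] [Fintype n] [DecidableEq n]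

open Polynomial in
theorem aeval_mul_of_intertwine {K : Matrix m m ℂ} {P : Matrix m n ℂ} {N : Matrix n n ℂ}
    (h : K * P = P * N) (p : ℂ[X]) : aeval K p * P = P * aeval N p := by
  induction p using Polynomial.induction_on' with
  | add p q hp hq => rw [map_add, map_add, Matrix.add_mul, Matrix.mul_add, hp, hq]
  | monomial k a =>
    have hk : K ^ k * P = P * N ^ k := by
      induction k with
      | zero => simp
      | succ k ih => rw [pow_succ', pow_succ', Matrix.mul_assoc, ih, ← Matrix.mul_assoc, h,
          Matrix.mul_assoc]
    rw [aeval_monomial, aeval_monomial, ← Algebra.smul_def, ← Algebra.smul_def,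
      Matrix.smul_mul, hk, Matrix.mul_smul]

open Polynomial in
/-- The two characteristic polynomials are coprime, so the one of `M` is invertible at `N`. -/
theorem exists_mul_aeval_charpoly_eq_one {M : Matrix n n ℂ} {N : Matrix m m ℂ}
    (h : Disjoint (spectrum ℂ M) (spectrum ℂ N)) :
    ∃ L : Matrix m m ℂ, L * aeval N M.charpoly = 1 := by
  have hco : IsCoprime M.charpoly N.charpoly := by
    rw [Polynomial.isCoprime_iff_aeval_ne_zero_of_isAlgClosed ℂ ℂ]
    intro a
    by_contra! hc
    simp only [coe_aeval_eq_eval] at hc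
    exact Set.disjoint_left.1 h (Matrix.mem_spectrum_iff_isRoot_charpoly.2 hc.1)
      (Matrix.mem_spectrum_iff_isRoot_charpoly.2 hc.2)
  obtain ⟨a, b, hab⟩ := hco
  refine ⟨aeval N a, ?_⟩
  have := congrArg (aeval N) hab
  rwa [map_add, map_mul, map_mul, Matrix.aeval_self_charpoly, mul_zero, add_zero, map_one] at this

/-- A homogeneous Sylvester equation whose coefficients share no eigenvalue has only the trivial
solution. -/
theorem eq_zero_of_sylvester {Q : Matrix m n ℂ} {M : Matrix n n ℂ} {N : Matrix m m ℂ}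
    (h : Q * M = N * Q) (hd : Disjoint (spectrum ℂ M) (spectrum ℂ N)) : Q = 0 := by
  obtain ⟨L, hL⟩ := exists_mul_aeval_charpoly_eq_one hd
  have h1 := aeval_mul_of_intertwine h.symm M.charpoly
  rw [Matrix.aeval_self_charpoly, Matrix.mul_zero] at h1
  rw [← Matrix.one_mul Q, ← hL, Matrix.mul_assoc, h1, Matrix.mul_zero]

/-- The spectrum of the restriction of `K` to the invariant subspace spanned by the columns of an
injective `P` is contained in the spectrum of `K`. -/
theorem spectrum_subset_of_intertwine {K : Matrix m m ℂ} {P : Matrix m n ℂ} {N : Matrix n n ℂ}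
    (h : K * P = P * N) {L : Matrix n m ℂ} (hL : L * P = 1) : spectrum ℂ N ⊆ spectrum ℂ K := by
  intro z hz
  contrapose! hz
  rw [spectrum.notMem_iff] at hz ⊢
  obtain ⟨J, hJ⟩ := hz.exists_left_inv
  have h1 : (algebraMap ℂ (Matrix m m ℂ) z - K) * P = P * (algebraMap ℂ (Matrix n n ℂ) z - N) := by
    rw [Matrix.sub_mul, Matrix.mul_sub, h, Algebra.algebraMap_eq_smul_one,
      Algebra.algebraMap_eq_smul_one, Matrix.smul_mul, Matrix.mul_smul, Matrix.one_mul,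
      Matrix.mul_one]
  refine IsUnit.of_mul_eq_one (L * J * P) ?_
  rw [mul_eq_one_comm, Matrix.mul_assoc, ← h1, Matrix.mul_assoc, ← Matrix.mul_assoc J, hJ,
    Matrix.one_mul, hL]

end Intertwine

/-! ### Invariant graph subspaces and uniqueness -/

section Riccati

variable {m n : Type*} [Fintype m] [DecidableEq m] [Fintype n] [DecidableEq n]
  {A : Matrix m m ℂ} {B : Matrix m n ℂ} {C : Matrix n m ℂ} {D : Matrix n n ℂ}
  {X : Matrix m n ℂ} {Y : Matrix n m ℂ}

omit [DecidableEq m] in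
theorem hamiltonian_mul_fromRows_one (h : X * C * X - X * D - A * X + B = 0) :
    hamiltonian A B C D * (Matrix.fromRows 1 X : Matrix (n ⊕ m) n ℂ) =
      Matrix.fromRows 1 X * (D - C * X) := by
  rw [hamiltonian, Matrix.fromBlocks_mul_fromRows, Matrix.fromRows_mul]
  have : B - A * X = X * (D - C * X) := by
    rw [Matrix.mul_sub, ← Matrix.mul_assoc, ← sub_eq_zero, ← h]; abel
  rw [← this]
  simp [sub_eq_add_neg]

omit [DecidableEq n] in
theorem hamiltonian_mul_fromRows_dual (h : Y * B * Y - Y * A - D * Y + C = 0) :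
    hamiltonian A B C D * (Matrix.fromRows Y 1 : Matrix (n ⊕ m) m ℂ) =
      Matrix.fromRows Y 1 * (B * Y - A) := by
  rw [hamiltonian, Matrix.fromBlocks_mul_fromRows, Matrix.fromRows_mul]
  have : D * Y - C = Y * (B * Y - A) := by
    rw [Matrix.mul_sub, ← Matrix.mul_assoc, ← sub_eq_zero, ← neg_eq_zero, ← h]; abel
  rw [← this]
  simp [sub_eq_add_neg]

theorem spectrum_closedLoop_subset (h : X * C * X - X * D - A * X + B = 0) :
    spectrum ℂ (D - C * X) ⊆ spectrum ℂ (hamiltonian A B C D) :=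
  spectrum_subset_of_intertwine (hamiltonian_mul_fromRows_one h)
    (L := Matrix.fromCols 1 0) (by simp [Matrix.fromCols_mul_fromRows])

theorem spectrum_dual_closedLoop_subset (h : Y * B * Y - Y * A - D * Y + C = 0) :
    spectrum ℂ (B * Y - A) ⊆ spectrum ℂ (hamiltonian A B C D) :=
  spectrum_subset_of_intertwine (hamiltonian_mul_fromRows_dual h)
    (L := Matrix.fromCols 0 1) (by simp [Matrix.fromCols_mul_fromRows])

omit [DecidableEq n] in
theorem neg_mem_spectrum_closedLoop {z : ℂ} :
    z ∈ spectrum ℂ (B * Y - A) ↔ -z ∈ spectrum ℂ (A - B * Y) := by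
  rw [← neg_sub A, ← spectrum.neg_eq, Set.mem_neg]

theorem disjoint_spectrum_closedLoop (hX : ∀ z ∈ spectrum ℂ (D - C * X), z.re < 0)
    (hY : ∀ z ∈ spectrum ℂ (A - B * Y), z.re < 0) :
    Disjoint (spectrum ℂ (D - C * X)) (spectrum ℂ (B * Y - A)) := by
  refine Set.disjoint_left.2 fun z hz hz' => ?_
  have h1 := hX z hz
  have h2 := hY _ (neg_mem_spectrum_closedLoop.1 hz')
  rw [Complex.neg_re] at h2
  linarith

/-- The graph subspaces of a stabilizing solution `X` and of a dual stabilizing solution `Y` are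
complementary: they are invariant under the Hamiltonian-like matrix, with disjoint spectra. In
terms of `X` and `Y`, this says that `1 - X * Y` is invertible. -/
theorem isUnit_one_sub_mul (hX : IsStabilizingSolution A B C D X)
    (hY : IsStabilizingSolution D C B A Y) : IsUnit (1 - X * Y) := by
  obtain ⟨L, hL⟩ := exists_mul_aeval_charpoly_eq_one (disjoint_spectrum_closedLoop hX.2 hY.2)
  have h1 := aeval_mul_of_intertwine (hamiltonian_mul_fromRows_one hX.1) (D - C * X).charpoly
  have h2 := aeval_mul_of_intertwine (hamiltonian_mul_fromRows_dual hY.1) (D - C * X).charpoly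
  rw [Matrix.aeval_self_charpoly, Matrix.mul_zero] at h1
  rw [Matrix.isUnit_iff_isUnit_det, isUnit_iff_ne_zero, Ne, ← Matrix.exists_mulVec_eq_zero_iff]
  rintro ⟨v, hv0, hv⟩
  apply hv0
  -- a vector in the kernel of `1 - X * Y` lies in both graphs
  have hgraph : (Matrix.fromRows Y 1).mulVec v =
      (Matrix.fromRows (1 : Matrix n n ℂ) X).mulVec (Y.mulVec v) := by
    rw [Matrix.sub_mulVec, Matrix.one_mulVec, sub_eq_zero] at hv
    rw [Matrix.fromRows_mulVec, Matrix.fromRows_mulVec, Matrix.one_mulVec, Matrix.one_mulVec,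
      Matrix.mulVec_mulVec, ← hv]
  have h3 := congrArg (fun Z => Z.mulVec v) h2
  simp only [← Matrix.mulVec_mulVec] at h3
  rw [hgraph, Matrix.mulVec_mulVec, h1, Matrix.zero_mulVec, Matrix.fromRows_mulVec] at h3
  have h4 : (Polynomial.aeval (B * Y - A) (D - C * X).charpoly).mulVec v = 0 := by
    funext i
    have := congrFun h3 (Sum.inr i)
    simpa using this.symm
  rw [← Matrix.one_mulVec v, ← hL, ← Matrix.mulVec_mulVec, h4, Matrix.mulVec_zero]

theorem IsStabilizingSolution.unique {X' : Matrix m n ℂ} (hX : IsStabilizingSolution A B C D X)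
    (hX' : IsStabilizingSolution A B C D X') (hY : IsStabilizingSolution D C B A Y) : X' = X := by
  obtain ⟨J, hJ⟩ := (isUnit_one_sub_mul hX' hY).exists_left_inv
  have hJ' := mul_eq_one_comm.1 hJ
  -- hence `X' * C - A` is similar to `B * Y - A`, which shares no eigenvalue with `D - C * X`
  have hinter : (X' * C - A) * (1 - X' * Y) = (1 - X' * Y) * (B * Y - A) := by
    have e1 := hX'.1
    have e2 := hY.1
    have : (X' * C - A) * (1 - X' * Y) - (1 - X' * Y) * (B * Y - A) =
        X' * (Y * B * Y - Y * A - D * Y + C) - (X' * C * X' - X' * D - A * X' + B) * Y := by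
      simp only [Matrix.mul_sub, Matrix.sub_mul, Matrix.mul_add, Matrix.add_mul, Matrix.mul_assoc,
        Matrix.mul_one, Matrix.one_mul]
      abel
    rw [e1, e2, Matrix.mul_zero, Matrix.zero_mul, sub_zero] at this
    exact sub_eq_zero.1 this
  have hspec : spectrum ℂ (X' * C - A) ⊆ spectrum ℂ (B * Y - A) := by
    refine spectrum_subset_of_intertwine (P := J) (L := 1 - X' * Y) ?_ hJ'
    calc (B * Y - A) * J = J * ((1 - X' * Y) * (B * Y - A)) * J := by
          rw [← Matrix.mul_assoc, hJ, Matrix.one_mul]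
      _ = J * (X' * C - A) := by
          rw [← hinter, Matrix.mul_assoc, Matrix.mul_assoc, hJ', Matrix.mul_one]
  refine sub_eq_zero.1 (eq_zero_of_sylvester (M := D - C * X) (N := X' * C - A) ?_
    ((disjoint_spectrum_closedLoop hX.2 hY.2).mono_right hspec))
  have : (X' - X) * (D - C * X) - (X' * C - A) * (X' - X) =
      (X * C * X - X * D - A * X + B) - (X' * C * X' - X' * D - A * X' + B) := by
    simp only [Matrix.mul_sub, Matrix.sub_mul, Matrix.mul_assoc]
    abel
  rw [hX.1, hX'.1, sub_zero] at this
  exact sub_eq_zero.1 this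

end Riccati

/-! ### Cayley transforms and the exact error formula -/

section Cayley

variable {m n : Type*} [Fintype m] [DecidableEq m] [Fintype n] [DecidableEq n]
  {A : Matrix m m ℂ} {B : Matrix m n ℂ} {C : Matrix n m ℂ} {D : Matrix n n ℂ} {α β : ℂ}
  {X : Matrix m n ℂ} {Y : Matrix n m ℂ}

/-- The conditions on the shift pair are invariant under passing to the dual equation. -/
theorem AdmissibleShift.dual (h : AdmissibleShift A B C D α β) :
    AdmissibleShift D C B A β α where
  isUnit_D := h.isUnit_A
  isUnit_A := h.isUnit_D
  isUnit_schur_A := by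
    -- both Schur complements are invertible exactly if the matrix `[[A_β, B], [C, D_α]]` is
    have := h.isUnit_A.invertible
    have := h.isUnit_D.invertible
    have h1 := h.isUnit_schur_A
    rw [← Matrix.invOf_eq_nonsing_inv] at h1 ⊢
    exact Matrix.isUnit_fromBlocks_iff_of_invertible₁₁.1
      (Matrix.isUnit_fromBlocks_iff_of_invertible₂₂.2 h1)
  isUnit_schur_A' := h.isUnit_schur_D
  isUnit_schur_D := h.isUnit_schur_A'

/-- The matrix `α + ℋ` is invertible, because the Schur complement of its block `D_α` is. -/
theorem AdmissibleShift.neg_notMem_spectrum (h : AdmissibleShift A B C D α β) :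
    -α ∉ spectrum ℂ (hamiltonian A B C D) := by
  have := h.isUnit_D.invertible
  rw [spectrum.notMem_iff, ← IsUnit.neg_iff]
  have hblocks : -(algebraMap ℂ (Matrix (n ⊕ m) (n ⊕ m) ℂ) (-α) - hamiltonian A B C D) =
      Matrix.fromBlocks (shift α D) (-C) B (-shift (-α) A) := by
    rw [Algebra.algebraMap_eq_smul_one, hamiltonian, shift, shift, ← Matrix.fromBlocks_one,
      Matrix.fromBlocks_smul, sub_eq_add_neg, Matrix.fromBlocks_neg, Matrix.fromBlocks_add,
      Matrix.fromBlocks_neg]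
    congr 1 <;> simp [add_comm]
  rw [hblocks, Matrix.isUnit_fromBlocks_iff_of_invertible₁₁, Matrix.invOf_eq_nonsing_inv,
    ← IsUnit.neg_iff]
  convert h.isUnit_schur_A' using 1
  simp [sub_eq_add_neg, add_comm]

theorem AdmissibleShift.isUnit_shift_closedLoop (h : AdmissibleShift A B C D α β)
    (hX : X * C * X - X * D - A * X + B = 0) : IsUnit (shift α (D - C * X)) := by
  have h1 : -α ∉ spectrum ℂ (D - C * X) :=
    fun hz => h.neg_notMem_spectrum (spectrum_closedLoop_subset hX hz)
  rw [spectrum.notMem_iff, ← IsUnit.neg_iff] at h1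
  convert h1 using 1
  rw [Algebra.algebraMap_eq_smul_one, shift, neg_smul]
  abel

omit [Fintype n] in
theorem shift_neg_eq (M : Matrix n n ℂ) : shift (-β) M = shift α M - (α + β) • 1 := by
  rw [shift, shift]
  module

/-- The first block row of the identity
`(β - ℋ) * [1; X] = (α + ℋ) * [1; X] * cayley α β (D - C * X)`. -/
theorem first_row_cayley (h : AdmissibleShift A B C D α β)
    (hX : X * C * X - X * D - A * X + B = 0) :
    (shift α D - C * X) * cayley α β (D - C * X) = (α + β) • 1 - (shift α D - C * X) := by
  have hM : shift α D - C * X = shift α (D - C * X) := by rw [shift, shift, add_sub_assoc]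
  have hu := (Matrix.isUnit_iff_isUnit_det _).1 (h.isUnit_shift_closedLoop hX)
  rw [hM, cayley, show α • (1 : Matrix n n ℂ) + (D - C * X) = shift α (D - C * X) from rfl,
    Matrix.mul_nonsing_inv_cancel_left _ _ hu, shift]
  module

/-- The second block row of the identity
`(β - ℋ) * [1; X] = (α + ℋ) * [1; X] * cayley α β (D - C * X)`. -/
theorem second_row_cayley (h : AdmissibleShift A B C D α β)
    (hX : X * C * X - X * D - A * X + B = 0) :
    (B - shift (-α) A * X) * cayley α β (D - C * X) = shift β A * X - B := by
  have hrow : B - shift (-α) A * X = X * (shift α D - C * X) := by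
    rw [← sub_eq_zero, ← hX, shift, shift]
    simp only [Matrix.mul_sub, Matrix.add_mul, Matrix.mul_add, Matrix.smul_mul, Matrix.mul_smul,
      Matrix.one_mul, Matrix.mul_one, Matrix.mul_assoc]
    module
  rw [hrow, Matrix.mul_assoc, first_row_cayley h hX, Matrix.mul_sub, ← hrow, shift, shift]
  simp only [Matrix.add_mul, Matrix.smul_mul, Matrix.mul_smul, Matrix.one_mul, Matrix.mul_one]
  module

/-- Eliminating `B` from the first block row of the Cayley-transformed invariant subspace relation
for the graph of `X`. -/
theorem E₀_eq (h : AdmissibleShift A B C D α β) (hX : X * C * X - X * D - A * X + B = 0) :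
    E₀ A B C D α β = (1 - G₀ A B C D α β * X) * cayley α β (D - C * X) := by
  have h1 := first_row_cayley h hX
  have h2 := congrArg (C * (shift β A)⁻¹ * ·) (second_row_cayley h hX)
  have hu := (Matrix.isUnit_iff_isUnit_det _).1 h.dual.isUnit_schur_A
  have ha := (Matrix.isUnit_iff_isUnit_det _).1 h.isUnit_A
  have key : -(shift (-β) D - C * (shift β A)⁻¹ * B) =
      ((shift α D - C * (shift β A)⁻¹ * B) - (α + β) • (C * (shift β A)⁻¹ * X)) *
        cayley α β (D - C * X) := by
    rw [shift_neg_eq (α := α) D]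
    rw [shift_neg_eq (α := β) A] at h2
    simp only [Matrix.sub_mul, Matrix.mul_sub, Matrix.smul_mul, Matrix.mul_smul, Matrix.one_mul,
      Matrix.mul_assoc, Matrix.nonsing_inv_mul_cancel_left _ _ ha] at h1 h2 ⊢
    linear_combination (norm := module) h2 - h1
  rw [E₀, G₀, ← Matrix.mul_neg, key]
  have hcancel : ∀ Z : Matrix n n ℂ, (shift α D - C * (shift β A)⁻¹ * B)⁻¹ *
      ((shift α D - C * (shift β A)⁻¹ * B) * Z) = Z :=
    fun Z => Matrix.nonsing_inv_mul_cancel_left _ Z hu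
  rw [Matrix.sub_mul _ _ (cayley _ _ _), Matrix.mul_sub, hcancel, Matrix.sub_mul 1, Matrix.one_mul]
  simp only [Matrix.smul_mul, Matrix.mul_smul, Matrix.mul_assoc]

/-- Eliminating `D` from the second block row of the Cayley-transformed invariant subspace relation
for the graph of `X`. -/
theorem sub_H₀_eq (h : AdmissibleShift A B C D α β) (hX : X * C * X - X * D - A * X + B = 0) :
    X - H₀ A B C D α β = F₀ A B C D α β * X * cayley α β (D - C * X) := by
  have h1 := congrArg (B * (shift α D)⁻¹ * ·) (first_row_cayley h hX)
  have h2 := second_row_cayley h hX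
  have hu := (Matrix.isUnit_iff_isUnit_det _).1 h.isUnit_schur_A
  have hd := (Matrix.isUnit_iff_isUnit_det _).1 h.isUnit_D
  have key : (shift β A - B * (shift α D)⁻¹ * C) * X - (α + β) • (B * (shift α D)⁻¹) =
      -((shift (-α) A - B * (shift α D)⁻¹ * C) * (X * cayley α β (D - C * X))) := by
    simp only [Matrix.sub_mul, Matrix.mul_sub, Matrix.mul_smul, Matrix.mul_one,
      Matrix.mul_assoc, Matrix.nonsing_inv_mul_cancel_left _ _ hd,
      Matrix.nonsing_inv_mul _ hd] at h1 h2 ⊢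
    linear_combination (norm := module) h1 - h2
  have hcancel : (shift β A - B * (shift α D)⁻¹ * C)⁻¹ *
      ((shift β A - B * (shift α D)⁻¹ * C) * X) = X :=
    Matrix.nonsing_inv_mul_cancel_left _ X hu
  have := congrArg ((shift β A - B * (shift α D)⁻¹ * C)⁻¹ * ·) key
  rw [Matrix.mul_sub, hcancel] at this
  rw [H₀, F₀]
  simp only [Matrix.mul_smul, Matrix.mul_neg, Matrix.neg_mul, Matrix.mul_assoc] at this ⊢
  exact this

/-- One step of the iteration, for arbitrary coefficients related by the two Cayley-transformed
invariant subspace relations. -/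
theorem sub_step_eq {E R : Matrix n n ℂ} {F S : Matrix m m ℂ} {G : Matrix n m ℂ}
    {H Z P : Matrix m n ℂ} (hE : E = (1 - G * X) * R) (hH : X - H = F * X * R)
    (hF : F = (1 - H * Y) * S) (hG : Y - G = E * Y * S) (hZ : IsUnit (1 - G * Z))
    (hP : X - Z = (1 - Z * Y) * P) :
    X - (H + F * Z * (1 - G * Z)⁻¹ * E) =
      (1 - (H + F * Z * (1 - G * Z)⁻¹ * E) * Y) * (S * P * R) := by
  obtain ⟨W, hW⟩ : ∃ W, W = (1 - G * Z)⁻¹ := ⟨_, rfl⟩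
  have hWG : W * (1 - G * Z) = 1 := by
    rw [hW, Matrix.nonsing_inv_mul _ ((Matrix.isUnit_iff_isUnit_det _).1 hZ)]
  rw [← hW]
  have hWGZ : W * (G * Z) = W - 1 := by
    rw [Matrix.mul_sub, Matrix.mul_one] at hWG
    rw [← hWG, sub_sub_cancel]
  -- both sides reduce to a multiple of `1 + Z * W * G`, the inverse of `1 - Z * G`
  have hleft : X - (H + F * Z * W * E) = F * (1 + Z * W * G) * (X - Z) * R := by
    have h1 : X - (H + F * Z * W * E) = F * X * R - F * Z * W * E := by rw [← hH]; abel
    rw [h1, hE]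
    simp only [Matrix.mul_sub, Matrix.sub_mul, Matrix.mul_add, Matrix.add_mul, Matrix.mul_one,
      Matrix.one_mul, Matrix.mul_assoc]
    have h2 : W * (G * (Z * R)) = W * R - R := by
      rw [← Matrix.mul_assoc G, ← Matrix.mul_assoc W, hWGZ, Matrix.sub_mul, Matrix.one_mul]
    rw [h2]
    simp only [Matrix.mul_sub]
    abel
  have hright : (1 - (H + F * Z * W * E) * Y) * S = F * (1 + Z * W * G) * (1 - Z * Y) := by
    have h1 : (1 - (H + F * Z * W * E) * Y) * S = (1 - H * Y) * S - F * Z * W * (E * Y * S) := by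
      simp only [Matrix.sub_mul, Matrix.add_mul, Matrix.mul_assoc]
      abel
    rw [h1, ← hF, ← hG]
    simp only [Matrix.mul_sub, Matrix.mul_add, Matrix.add_mul, Matrix.mul_one,
      Matrix.mul_assoc]
    have h2 : W * (G * (Z * Y)) = W * Y - Y := by
      rw [← Matrix.mul_assoc G, ← Matrix.mul_assoc W, hWGZ, Matrix.sub_mul, Matrix.one_mul]
    rw [h2]
    simp only [Matrix.mul_sub]
    abel
  rw [hleft, hP, Matrix.mul_assoc S, ← Matrix.mul_assoc _ S, hright]
  simp only [Matrix.mul_assoc]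

/-- The exact error formula, by induction on `t`. -/
theorem sub_iter_eq (h : AdmissibleShift A B C D α β) (hiter : NoBreakdown A B C D α β)
    (hX : X * C * X - X * D - A * X + B = 0) (hY : Y * B * Y - Y * A - D * Y + C = 0) (t : ℕ) :
    X - iter A B C D α β t = (1 - iter A B C D α β t * Y) *
      ((-cayley β α (A - B * Y)) ^ t * X * (-cayley α β (D - C * X)) ^ t) := by
  have hG₀ : H₀ D C B A β α = G₀ A B C D α β := by rw [H₀, G₀, add_comm]
  have hH₀ : G₀ D C B A β α = H₀ A B C D α β := by rw [H₀, G₀, add_comm]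
  have hF := E₀_eq h.dual hY
  have hG := sub_H₀_eq h.dual hY
  rw [hH₀] at hF
  rw [hG₀] at hG
  induction t with
  | zero => simp [iter]
  | succ t ih =>
    have := sub_step_eq (E₀_eq h hX) (sub_H₀_eq h hX) hF hG (hiter t) ih
    rw [iter, this]
    congr 1
    rw [pow_succ', pow_succ]
    simp only [Matrix.mul_assoc, Matrix.neg_mul, Matrix.mul_neg, neg_neg]

/-- One half of the spectral mapping theorem for the Cayley transform. -/
theorem spectrum_cayley_subset {M : Matrix n n ℂ} (h : IsUnit (shift α M)) :
    spectrum ℂ (cayley α β M) ⊆ cayleyScalar α β '' spectrum ℂ M := by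
  intro μ hμ
  have hα : ∀ z ∈ spectrum ℂ M, α + z ≠ 0 := by
    intro z hz h0
    rw [spectrum.mem_iff, eq_neg_of_add_eq_zero_right h0, ← IsUnit.neg_iff] at hz
    apply hz
    convert h using 1
    rw [Algebra.algebraMap_eq_smul_one, shift, neg_smul]
    abel
  have hnu : ¬ IsUnit ((μ + 1) • M + (μ * α - β) • (1 : Matrix n n ℂ)) := by
    have : (μ + 1) • M + (μ * α - β) • (1 : Matrix n n ℂ) =
        shift α M * (algebraMap ℂ (Matrix n n ℂ) μ - cayley α β M) := by
      rw [cayley, Matrix.mul_sub]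
      rw [show α • (1 : Matrix n n ℂ) + M = shift α M from rfl,
        Matrix.mul_nonsing_inv_cancel_left _ _ ((Matrix.isUnit_iff_isUnit_det _).1 h),
        Algebra.algebraMap_eq_smul_one, Matrix.mul_smul, Matrix.mul_one, shift]
      module
    rw [this, h.mul_left_iff]
    exact hμ
  rcases eq_or_ne (μ + 1) 0 with h1 | h1
  · -- the value `-1` is taken only if the transform is constant
    have h2 : μ = -1 := eq_neg_of_add_eq_zero_left h1
    have h3 : α + β = 0 := by
      by_contra h3
      apply hnu
      rw [h1, zero_smul, zero_add, h2]
      exact isUnit_one.smul (Units.mk0 (-1 * α - β) (by contrapose! h3; linear_combination -h3))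
    have : Nonempty n := by
      by_contra hn
      rw [not_nonempty_iff] at hn
      exact hnu (isUnit_of_subsingleton _)
    obtain ⟨z, hz⟩ := spectrum.nonempty_of_isAlgClosed_of_finiteDimensional ℂ M
    refine ⟨z, hz, ?_⟩
    rw [cayleyScalar, inv_mul_eq_iff_eq_mul₀ (hα z hz), h2]
    linear_combination h3
  · -- otherwise the preimage of `μ` is `(β - μ * α) / (μ + 1)`
    have hz : (β - μ * α) / (μ + 1) ∈ spectrum ℂ M := by
      intro hu
      apply hnu
      have : (μ + 1) • M + (μ * α - β) • (1 : Matrix n n ℂ) =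
          (-(μ + 1)) • (algebraMap ℂ (Matrix n n ℂ) ((β - μ * α) / (μ + 1)) - M) := by
        rw [Algebra.algebraMap_eq_smul_one, smul_sub, smul_smul, neg_mul, mul_div_cancel₀ _ h1]
        module
      rw [this]
      exact IsUnit.smul (Units.mk0 _ (neg_ne_zero.2 h1)) hu
    refine ⟨_, hz, ?_⟩
    rw [cayleyScalar, inv_mul_eq_iff_eq_mul₀ (hα _ hz)]
    field_simp
    ring

/-- The spectral separation condition, in terms of the Cayley transforms of the closed-loop
matrices. The eigenvalues of `A - B * Y` are the negatives of eigenvalues of the Hamiltonian-like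
matrix, and `cayleyScalar β α z` is the inverse of `cayleyScalar α β (-z)`. -/
theorem spectralRadius_mul_lt_one (h : AdmissibleShift A B C D α β)
    (hX : IsStabilizingSolution A B C D X) (hY : IsStabilizingSolution D C B A Y)
    (hsep : SpectralSeparation A B C D α β) :
    spectralRadius ℂ (-cayley α β (D - C * X)) * spectralRadius ℂ (-cayley β α (A - B * Y)) < 1 := by
  -- a matrix of size zero has spectral radius zero
  rcases subsingleton_or_nontrivial (Matrix n n ℂ) with hn | hn
  · rw [spectrum.SpectralRadius.of_subsingleton, zero_mul]; exact one_pos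
  rcases subsingleton_or_nontrivial (Matrix m m ℂ) with hm | hm
  · rw [spectrum.SpectralRadius.of_subsingleton (-cayley β α (A - B * Y)), mul_zero]; exact one_pos
  obtain ⟨μ, hμ, hμR⟩ := spectrum.exists_nnnorm_eq_spectralRadius (-cayley α β (D - C * X))
  obtain ⟨ν, hν, hνS⟩ := spectrum.exists_nnnorm_eq_spectralRadius (-cayley β α (A - B * Y))
  rw [← spectrum.neg_eq, Set.mem_neg] at hμ hν
  obtain ⟨z, hz, hzμ⟩ := spectrum_cayley_subset (h.isUnit_shift_closedLoop hX.1) hμ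
  obtain ⟨w, hw, hwν⟩ := spectrum_cayley_subset (h.dual.isUnit_shift_closedLoop hY.1) hν
  have hw' : -w ∈ spectrum ℂ (hamiltonian A B C D) := by
    apply spectrum_dual_closedLoop_subset hY.1
    rwa [neg_mem_spectrum_closedLoop, neg_neg]
  have hlt := hsep z (spectrum_closedLoop_subset hX.1 hz) (hX.2 z hz) (-w) hw' (by
    have := hY.2 w hw
    rw [Complex.neg_re]; linarith)
  have hinv : (cayleyScalar α β (-w))⁻¹ = cayleyScalar β α w := by
    rw [cayleyScalar, cayleyScalar, mul_inv, inv_inv, mul_comm, sub_neg_eq_add, ← sub_eq_add_neg]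
  rw [hinv, hwν, hzμ, norm_inv, norm_neg, norm_neg] at hlt
  have hμ0 : 0 < ‖μ‖ := inv_pos.1 ((norm_nonneg ν).trans_lt hlt)
  have hprod : ‖μ‖ * ‖ν‖ < 1 := by
    calc ‖μ‖ * ‖ν‖ < ‖μ‖ * ‖μ‖⁻¹ := mul_lt_mul_of_pos_left hlt hμ0
      _ = 1 := mul_inv_cancel₀ hμ0.ne'
  rw [← hμR, ← hνS, ← ENNReal.coe_mul, ENNReal.coe_lt_one_iff, ← NNReal.coe_lt_coe]
  simpa using hprod

end Cayley

/-! ### Asymptotic rates of orbits of linear operators -/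

theorem spectralRadius_ne_top {𝔸 : Type*} [NormedRing 𝔸] [NormedAlgebra ℂ 𝔸] [CompleteSpace 𝔸]
    (a : 𝔸) : spectralRadius ℂ a ≠ ⊤ := by
  cases subsingleton_or_nontrivial 𝔸
  · rw [spectrum.SpectralRadius.of_subsingleton]; exact ENNReal.zero_ne_top
  · obtain ⟨z, -, hz⟩ := spectrum.exists_nnnorm_eq_spectralRadius a
    rw [← hz]; exact ENNReal.coe_ne_top

/-- Gelfand's formula as a limit of real numbers. -/
theorem tendsto_norm_pow_root {𝔸 : Type*} [NormedRing 𝔸] [NormedAlgebra ℂ 𝔸] [CompleteSpace 𝔸]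
    (a : 𝔸) : Tendsto (fun t : ℕ => ‖a ^ t‖ ^ (1 / (t : ℝ))) atTop
      (𝓝 (spectralRadius ℂ a).toReal) := by
  have h := spectrum.pow_norm_pow_one_div_tendsto_nhds_spectralRadius a
  have h2 := (ENNReal.tendsto_toReal (spectralRadius_ne_top a)).comp h
  refine h2.congr fun t => ?_
  exact ENNReal.toReal_ofReal (by positivity)

theorem tendsto_const_root {c : ℝ} (hc : 0 < c) :
    Tendsto (fun t : ℕ => c ^ (1 / (t : ℝ))) atTop (𝓝 1) := by
  have h : Tendsto (fun t : ℕ => 1 / (t : ℝ)) atTop (𝓝 0) := tendsto_one_div_atTop_nhds_zero_nat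
  simpa using tendsto_const_nhds.rpow h (Or.inl hc.ne')

/-- Two nonnegative sequences that bound each other up to positive constants have the same
asymptotic rate. -/
theorem tendsto_root_of_le_of_le {a b : ℕ → ℝ} {c c' r : ℝ} (ha : ∀ t, 0 ≤ a t) (hb : ∀ t, 0 ≤ b t)
    (hc : 0 < c) (hc' : 0 < c') (h₁ : ∀ᶠ t in atTop, a t ≤ c * b t)
    (h₂ : ∀ᶠ t in atTop, b t ≤ c' * a t)
    (h : Tendsto (fun t : ℕ => a t ^ (1 / (t : ℝ))) atTop (𝓝 r)) :
    Tendsto (fun t : ℕ => b t ^ (1 / (t : ℝ))) atTop (𝓝 r) := by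
  have hlo := (tendsto_const_root (inv_pos.2 hc)).mul h
  have hhi := (tendsto_const_root hc').mul h
  rw [one_mul] at hlo hhi
  refine tendsto_of_tendsto_of_tendsto_of_le_of_le' hlo hhi ?_ ?_
  · filter_upwards [h₁] with t ht
    rw [← Real.mul_rpow (inv_pos.2 hc).le (ha t)]
    refine Real.rpow_le_rpow (mul_nonneg (inv_pos.2 hc).le (ha t)) ?_ (by positivity)
    rwa [inv_mul_le_iff₀ hc]
  · filter_upwards [h₂] with t ht
    rw [← Real.mul_rpow hc'.le (ha t)]
    exact Real.rpow_le_rpow (hb t) ht (by positivity)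

/-- A sequence whose `t`-th roots have a limit less than one tends to zero. -/
theorem tendsto_zero_of_tendsto_root {a : ℕ → ℝ} {r : ℝ} (ha : ∀ t, 0 ≤ a t) (hr : r < 1)
    (h : Tendsto (fun t : ℕ => a t ^ (1 / (t : ℝ))) atTop (𝓝 r)) : Tendsto a atTop (𝓝 0) := by
  obtain ⟨q, hrq, hq⟩ := exists_between hr
  have hr0 : 0 ≤ r := ge_of_tendsto' h fun t => Real.rpow_nonneg (ha t) _
  refine squeeze_zero' (Eventually.of_forall ha) ?_
    (tendsto_pow_atTop_nhds_zero_of_lt_one (hr0.trans hrq.le) hq)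
  filter_upwards [h.eventually_lt_const hrq, eventually_ne_atTop 0] with t ht ht0
  calc a t = (a t ^ (1 / (t : ℝ))) ^ t := by
        rw [one_div, Real.rpow_inv_natCast_pow (ha t) ht0]
    _ ≤ q ^ t := pow_le_pow_left₀ (Real.rpow_nonneg (ha t) _) ht.le t

/-- If the orbit of `v` under `T` spans the space, its growth is that of the powers of `T`: each
orbit is bounded by a multiple of the orbit of `v`, and the uniform boundedness principle turns
this into a bound for `‖T ^ t‖`. -/
theorem exists_norm_pow_le_of_span_eq_top {E : Type*} [NormedAddCommGroup E] [NormedSpace ℂ E]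
    [CompleteSpace E] (T : E →L[ℂ] E) (v : E)
    (hv : Submodule.span ℂ (Set.range fun k : ℕ => (T ^ k) v) = ⊤) :
    ∃ c : ℝ, 0 < c ∧ ∀ t : ℕ, ‖T ^ t‖ ≤ c * ‖(T ^ t) v‖ := by
  have hbound : ∀ x : E, ∃ c : ℝ, 0 ≤ c ∧ ∀ t : ℕ, ‖(T ^ t) x‖ ≤ c * ‖(T ^ t) v‖ := by
    intro x
    have hx : x ∈ Submodule.span ℂ (Set.range fun k : ℕ => (T ^ k) v) := hv ▸ Submodule.mem_top
    induction hx using Submodule.span_induction with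
    | mem x hx =>
      obtain ⟨k, rfl⟩ := hx
      refine ⟨‖T ^ k‖, norm_nonneg _, fun t => ?_⟩
      have : (T ^ t) ((T ^ k) v) = (T ^ k) ((T ^ t) v) :=
        DFunLike.congr_fun (Commute.pow_pow_self T t k).eq v
      rw [this]
      exact (T ^ k).le_opNorm _
    | zero => exact ⟨0, le_rfl, fun t => by simp⟩
    | add x y _ _ hx hy =>
      obtain ⟨c, hc0, hc⟩ := hx
      obtain ⟨d, hd0, hd⟩ := hy
      refine ⟨c + d, by positivity, fun t => ?_⟩
      rw [map_add, add_mul]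
      exact (norm_add_le _ _).trans (add_le_add (hc t) (hd t))
    | smul a x _ hx =>
      obtain ⟨c, hc0, hc⟩ := hx
      refine ⟨‖a‖ * c, by positivity, fun t => ?_⟩
      rw [map_smul, norm_smul, mul_assoc]
      exact mul_le_mul_of_nonneg_left (hc t) (norm_nonneg _)
  obtain ⟨c, hc⟩ := banach_steinhaus
    (g := fun t : ℕ => ((‖(T ^ t) v‖⁻¹ : ℝ) : ℂ) • T ^ t) (by
      intro x
      obtain ⟨c, hc0, hc⟩ := hbound x
      refine ⟨c, fun t => ?_⟩
      rw [smul_apply, norm_smul, Complex.norm_real, norm_inv, norm_norm]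
      rcases (norm_nonneg ((T ^ t) v)).eq_or_lt with h0 | h0
      · rw [← h0, inv_zero, zero_mul]; exact hc0
      · rw [inv_mul_le_iff₀ h0, mul_comm]; exact hc t)
  refine ⟨|c| + 1, by positivity, fun t => ?_⟩
  rcases (norm_nonneg ((T ^ t) v)).eq_or_lt with h0 | h0
  · -- here the orbit of `v`, hence the whole power of `T`, has vanished
    have : T ^ t = 0 := by
      ext x
      obtain ⟨d, -, hd⟩ := hbound x
      have := hd t
      rw [← h0, mul_zero, norm_le_zero_iff] at this
      rw [this, zero_apply]
    rw [this, zero_apply, norm_zero, norm_zero, mul_zero]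
  · have h1 := hc t
    rw [norm_smul, Complex.norm_real, norm_inv, norm_norm, inv_mul_le_iff₀ h0] at h1
    nlinarith [le_abs_self c]

/-- The orbit of every vector `v` under a linear operator `T` on a finite-dimensional complex space
has an asymptotic rate, namely the spectral radius of the restriction of `T` to the cyclic subspace
generated by `v`. -/
theorem exists_tendsto_norm_pow_apply_root {E : Type*} [NormedAddCommGroup E] [NormedSpace ℂ E]
    [FiniteDimensional ℂ E] (T : E →L[ℂ] E) (v : E) :
    ∃ r : ℝ, Tendsto (fun t : ℕ => ‖(T ^ t) v‖ ^ (1 / (t : ℝ))) atTop (𝓝 r) := by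
  obtain ⟨V, hV⟩ : ∃ V : Submodule ℂ E,
    V = Submodule.span ℂ (Set.range fun k : ℕ => (T ^ k) v) := ⟨_, rfl⟩
  have hmem : ∀ k : ℕ, (T ^ k) v ∈ V := fun k => hV ▸ Submodule.subset_span ⟨k, rfl⟩
  have hinv : ∀ x ∈ V, T x ∈ V := by
    have : V ≤ V.comap (T : E →ₗ[ℂ] E) := by
      conv_lhs => rw [hV]
      rw [Submodule.span_le]
      rintro _ ⟨k, rfl⟩
      have := hmem (k + 1)
      rw [pow_succ'] at this
      exact this
    exact fun x hx => this hx
  obtain ⟨U, hU⟩ : ∃ U : V →L[ℂ] V, ∀ x : V, ((U x : V) : E) = T x := ⟨T.restrict hinv, fun _ => rfl⟩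
  have hUpow : ∀ (t : ℕ) (x : V), (((U ^ t) x : V) : E) = (T ^ t) x := by
    intro t
    induction t with
    | zero => intro x; rfl
    | succ t ih =>
      intro x
      rw [pow_succ', pow_succ', mul_apply_eq_comp, mul_apply_eq_comp, ← ih, ← hU]
  have : CompleteSpace V := FiniteDimensional.complete ℂ V
  have hnorm : ∀ t : ℕ, ‖(U ^ t) ⟨v, hmem 0⟩‖ = ‖(T ^ t) v‖ := fun t =>
    congrArg norm (hUpow t ⟨v, hmem 0⟩)
  have hspan : Submodule.span ℂ (Set.range fun k : ℕ => (U ^ k) ⟨v, hmem 0⟩) = ⊤ := by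
    apply Submodule.map_injective_of_injective V.injective_subtype
    rw [Submodule.map_span, Submodule.map_top, Submodule.range_subtype, ← Set.range_comp]
    conv_rhs => rw [hV]
    congr 2
    funext k
    exact hUpow k ⟨v, hmem 0⟩
  obtain ⟨c, hc0, hc⟩ := exists_norm_pow_le_of_span_eq_top U ⟨v, hmem 0⟩ hspan
  refine ⟨_, tendsto_root_of_le_of_le (fun t => norm_nonneg (U ^ t)) (fun t => norm_nonneg _)
    hc0 (c' := ‖v‖ + 1) (by positivity) (Eventually.of_forall fun t => ?_)
    (Eventually.of_forall fun t => ?_) (tendsto_norm_pow_root U)⟩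
  · rw [← hnorm]; exact hc t
  · have h1 : ‖(U ^ t) ⟨v, hmem 0⟩‖ ≤ ‖U ^ t‖ * ‖v‖ := (U ^ t).le_opNorm ⟨v, hmem 0⟩
    rw [hnorm] at h1
    nlinarith [norm_nonneg (U ^ t)]

/-! ### Convergence and its rate -/

section Rate

variable {m n : Type*} [Fintype m] [DecidableEq m] [Fintype n] [DecidableEq n]
  {R : Matrix n n ℂ} {S : Matrix m m ℂ} {X : Matrix m n ℂ}

theorem norm_pow_mul_mul_pow_le (S : Matrix m m ℂ) (X : Matrix m n ℂ) (R : Matrix n n ℂ) (t : ℕ) :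
    ‖S ^ t * X * R ^ t‖ ≤ ‖X‖ * (‖R ^ t‖ * ‖S ^ t‖) :=
  calc ‖S ^ t * X * R ^ t‖ ≤ ‖S ^ t‖ * ‖X‖ * ‖R ^ t‖ :=
        (Matrix.l2_opNorm_mul _ _).trans
          (mul_le_mul_of_nonneg_right (Matrix.l2_opNorm_mul _ _) (norm_nonneg _))
    _ = ‖X‖ * (‖R ^ t‖ * ‖S ^ t‖) := by ring

theorem tendsto_norm_pow_mul_norm_pow_root (R : Matrix n n ℂ) (S : Matrix m m ℂ) :
    Tendsto (fun t : ℕ => (‖R ^ t‖ * ‖S ^ t‖) ^ (1 / (t : ℝ))) atTop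
      (𝓝 (spectralRadius ℂ R * spectralRadius ℂ S).toReal) := by
  rw [ENNReal.toReal_mul]
  refine ((tendsto_norm_pow_root R).mul (tendsto_norm_pow_root S)).congr fun t => ?_
  rw [Real.mul_rpow (norm_nonneg _) (norm_nonneg _)]

theorem tendsto_norm_pow_mul_mul_pow_zero (hlt : spectralRadius ℂ R * spectralRadius ℂ S < 1) :
    Tendsto (fun t : ℕ => ‖S ^ t * X * R ^ t‖) atTop (𝓝 0) := by
  have h1 : (spectralRadius ℂ R * spectralRadius ℂ S).toReal < 1 := by
    rw [← ENNReal.toReal_one]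
    exact (ENNReal.toReal_lt_toReal hlt.ne_top ENNReal.one_ne_top).2 hlt
  have h2 := (tendsto_zero_of_tendsto_root (fun t => by positivity) h1
    (tendsto_norm_pow_mul_norm_pow_root R S)).const_mul ‖X‖
  rw [mul_zero] at h2
  exact squeeze_zero (fun t => norm_nonneg _) (norm_pow_mul_mul_pow_le S X R) h2

/-- The rate of `S ^ t * X * R ^ t`, the orbit of `X` under the operator `Z ↦ S * Z * R`. -/
theorem exists_tendsto_norm_pow_mul_mul_pow_root (S : Matrix m m ℂ) (X : Matrix m n ℂ)
    (R : Matrix n n ℂ) : ∃ r : ℝ,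
      Tendsto (fun t : ℕ => ‖S ^ t * X * R ^ t‖ ^ (1 / (t : ℝ))) atTop (𝓝 r) ∧
      ENNReal.ofReal r ≤ spectralRadius ℂ R * spectralRadius ℂ S := by
  let T : Matrix m n ℂ →L[ℂ] Matrix m n ℂ := LinearMap.toContinuousLinearMap
    { toFun := fun Z => S * Z * R
      map_add' := fun Y Z => by rw [Matrix.mul_add, Matrix.add_mul]
      map_smul' := fun c Z => by rw [Matrix.mul_smul, Matrix.smul_mul]; rfl }
  have hT : ∀ t : ℕ, (T ^ t) X = S ^ t * X * R ^ t := by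
    intro t
    induction t with
    | zero => simp
    | succ t ih =>
      rw [pow_succ', mul_apply_eq_comp, ih]
      change S * (S ^ t * X * R ^ t) * R = _
      rw [pow_succ', pow_succ]
      simp only [Matrix.mul_assoc]
  obtain ⟨r, hr⟩ := exists_tendsto_norm_pow_apply_root T X
  simp only [hT] at hr
  refine ⟨r, hr, ?_⟩
  rw [ENNReal.ofReal_le_iff_le_toReal
    (ENNReal.mul_ne_top (spectralRadius_ne_top R) (spectralRadius_ne_top S))]
  have h1 := (tendsto_const_root (c := ‖X‖ + 1) (by positivity)).mul
    (tendsto_norm_pow_mul_norm_pow_root R S)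
  rw [one_mul] at h1
  refine le_of_tendsto_of_tendsto' hr h1 fun t => ?_
  rw [← Real.mul_rpow (by positivity) (by positivity)]
  refine Real.rpow_le_rpow (norm_nonneg _) ((norm_pow_mul_mul_pow_le S X R t).trans ?_)
    (by positivity)
  exact mul_le_mul_of_nonneg_right (by linarith) (by positivity)

/-- If `P t` tends to zero and the sequence `Z` satisfies the implicit error formula
`X - Z t = (1 - Z t * Y) * P t`, then the errors are bounded by a multiple of `P t`. -/
theorem exists_norm_sub_le {Y : Matrix n m ℂ} {Z P : ℕ → Matrix m n ℂ}
    (hZ : ∀ t, X - Z t = (1 - Z t * Y) * P t) (hP : Tendsto (fun t => ‖P t‖) atTop (𝓝 0)) :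
    ∃ c : ℝ, 0 < c ∧ ∀ᶠ t in atTop, ‖Z t - X‖ ≤ c * ‖P t‖ := by
  have hY := hP.const_mul ‖Y‖
  rw [mul_zero] at hY
  refine ⟨2 * (‖1 - X * Y‖ + 1), by positivity, ?_⟩
  filter_upwards [hY.eventually_le_const (show (0 : ℝ) < 1 / 2 by norm_num)] with t ht
  have h1 : X - Z t = (1 - X * Y) * P t + (X - Z t) * (Y * P t) := by
    conv_lhs => rw [hZ t]
    simp only [Matrix.sub_mul, Matrix.one_mul, Matrix.mul_assoc]
    abel
  have h2 : ‖X - Z t‖ ≤ ‖1 - X * Y‖ * ‖P t‖ + ‖X - Z t‖ * (‖Y‖ * ‖P t‖) := by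
    conv_lhs => rw [h1]
    refine (norm_add_le _ _).trans (add_le_add (Matrix.l2_opNorm_mul _ _) ?_)
    exact (Matrix.l2_opNorm_mul _ _).trans
      (mul_le_mul_of_nonneg_left (Matrix.l2_opNorm_mul _ _) (norm_nonneg _))
  rw [norm_sub_rev]
  nlinarith [mul_le_mul_of_nonneg_left ht (norm_nonneg (X - Z t)), norm_nonneg (P t)]

/-- If moreover `1 - X * Y` is invertible, then `P t` is bounded by a multiple of the error. -/
theorem exists_norm_le_norm_sub {Y : Matrix n m ℂ} {Z P : ℕ → Matrix m n ℂ}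
    (hK : IsUnit (1 - X * Y))
    (hZ : ∀ t, X - Z t = (1 - Z t * Y) * P t) (hP : Tendsto (fun t => ‖P t‖) atTop (𝓝 0)) :
    ∃ c : ℝ, 0 < c ∧ ∀ᶠ t in atTop, ‖P t‖ ≤ c * ‖Z t - X‖ := by
  obtain ⟨J, hJ⟩ := hK.exists_left_inv
  refine ⟨‖J‖ * (‖(1 : Matrix n n ℂ)‖ + ‖Y‖) + 1, by positivity, ?_⟩
  filter_upwards [hP.eventually_le_const one_pos] with t ht
  have h1 : P t = J * ((X - Z t) * (1 - Y * P t)) := by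
    have : (X - Z t) * (1 - Y * P t) = (1 - X * Y) * P t := by
      rw [Matrix.mul_sub, Matrix.mul_one]
      conv_lhs => enter [1]; rw [hZ t]
      simp only [Matrix.sub_mul, Matrix.one_mul, Matrix.mul_assoc]
      abel
    rw [this, ← Matrix.mul_assoc, hJ, Matrix.one_mul]
  have h2 : ‖1 - Y * P t‖ ≤ ‖(1 : Matrix n n ℂ)‖ + ‖Y‖ := by
    refine (norm_sub_le _ _).trans (add_le_add_right ((Matrix.l2_opNorm_mul _ _).trans ?_) _)
    exact mul_le_of_le_one_right (norm_nonneg _) ht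
  calc ‖P t‖ ≤ ‖J‖ * (‖X - Z t‖ * (‖(1 : Matrix n n ℂ)‖ + ‖Y‖)) := by
        conv_lhs => rw [h1]
        refine (Matrix.l2_opNorm_mul _ _).trans (mul_le_mul_of_nonneg_left ?_ (norm_nonneg _))
        exact (Matrix.l2_opNorm_mul _ _).trans (mul_le_mul_of_nonneg_left h2 (norm_nonneg _))
    _ ≤ _ := by
        rw [norm_sub_rev]
        nlinarith [norm_nonneg (Z t - X)]

end Rate
end NARE

open NARE in
theorem mainTheorem1 {m n : Type*} [Fintype m] [DecidableEq m] [Fintype n] [DecidableEq n]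
    (A : Matrix m m ℂ) (B : Matrix m n ℂ) (C : Matrix n m ℂ) (D : Matrix n n ℂ) (α β : ℂ)
    (Xs : Matrix m n ℂ) (hXs : NARE.IsStabilizingSolution A B C D Xs)
    (Ys : Matrix n m ℂ) (hYs : NARE.IsStabilizingSolution D C B A Ys)
    (hshift : NARE.AdmissibleShift A B C D α β)
    (hsep : NARE.SpectralSeparation A B C D α β)
    (hiter : NARE.NoBreakdown A B C D α β)
    (R : Matrix n n ℂ) (hR : R = -NARE.cayley α β (D - C * Xs))
    (S : Matrix m m ℂ) (hS : S = -NARE.cayley β α (A - B * Ys)) :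
    -- the stabilizing solutions of the equation and of its dual are unique
    (∀ X', NARE.IsStabilizingSolution A B C D X' → X' = Xs) ∧
    (∀ Y', NARE.IsStabilizingSolution D C B A Y' → Y' = Ys) ∧
    -- convergence
    Tendsto (NARE.iter A B C D α β) atTop (𝓝 Xs) ∧
    -- exact form of the error
    (∀ t, NARE.iter A B C D α β t =
      Xs - (1 - NARE.iter A B C D α β t * Ys) * S ^ t * Xs * R ^ t) ∧
    -- linear convergence with its asymptotic rate in the spectral norm
    spectralRadius ℂ R * spectralRadius ℂ S < 1 ∧
    (Xs ≠ 0 → ∃ r : ℝ,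
      Tendsto (fun t : ℕ => (‖NARE.iter A B C D α β t - Xs‖ / ‖Xs‖) ^ (1 / (t : ℝ))) atTop (𝓝 r) ∧
      ENNReal.ofReal r ≤ spectralRadius ℂ R * spectralRadius ℂ S) := by
  have herr : ∀ t, Xs - iter A B C D α β t =
      (1 - iter A B C D α β t * Ys) * (S ^ t * Xs * R ^ t) := by
    rw [hR, hS]
    exact sub_iter_eq hshift hiter hXs.1 hYs.1
  have hlt : spectralRadius ℂ R * spectralRadius ℂ S < 1 := by
    rw [hR, hS]
    exact spectralRadius_mul_lt_one hshift hXs hYs hsep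
  have hP : Tendsto (fun t : ℕ => ‖S ^ t * Xs * R ^ t‖) atTop (𝓝 0) :=
    tendsto_norm_pow_mul_mul_pow_zero hlt
  obtain ⟨c, hc0, hc⟩ := exists_norm_sub_le herr hP
  refine ⟨fun X' hX' => hXs.unique hX' hYs, fun Y' hY' => hYs.unique hY' hXs, ?_, fun t => ?_, hlt,
    fun hX0 => ?_⟩
  · rw [tendsto_iff_norm_sub_tendsto_zero]
    have := hP.const_mul c
    rw [mul_zero] at this
    exact squeeze_zero' (Eventually.of_forall fun t => norm_nonneg _) hc this
  · rw [Matrix.mul_assoc, Matrix.mul_assoc, ← Matrix.mul_assoc (S ^ t), ← herr t, sub_sub_cancel]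
  · obtain ⟨d, hd0, hd⟩ := exists_norm_le_norm_sub (isUnit_one_sub_mul hXs hYs) herr hP
    obtain ⟨r, hr, hrle⟩ := exists_tendsto_norm_pow_mul_mul_pow_root S Xs R
    have hX : 0 < ‖Xs‖ := norm_pos_iff.2 hX0
    refine ⟨r, tendsto_root_of_le_of_le (fun t => norm_nonneg _) (fun t => by positivity)
      (c := d * ‖Xs‖) (by positivity) (c' := c / ‖Xs‖) (by positivity) ?_ ?_ hr, hrle⟩
    · filter_upwards [hd] with t ht
      rwa [mul_assoc, mul_div_cancel₀ _ hX.ne']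
    · filter_upwards [hc] with t ht
      rw [div_mul_eq_mul_div]
      exact div_le_div_of_nonneg_right ht hX.le
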